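/- Let $n\ge 1$ and $p\ge 1$ be integers, and let $X_1,\ldots,X_n$ be independent real random variables with $\mathbb{E}|X_i|^{p+1}<\infty$ for $1\le i\le n$. Let $Z$ be a standard normal random variable, and for $1\le i\le n$ and integers $0\le k\le p$ put $\epsilon_{i,k}=\mathbb{E}X_i^k-\mathbb{E}Z^k$. Let $W_n=\frac{1}{\sqrt n}\sum_{i=1}^nX_i$, let $\|g\|=\sup_{x\in\mathbb{R}}|g(x)|$, and let $C_b^{p+1}(\mathbb{R})$ be the class of bounded functions $h:\mathbb{R}\to\mathbb{R}$ that are $p+1$ times differentiable with bounded derivatives of every order $k\le p+1$. Then, for all $h\in C_b^{p+1}(\mathbb{R})$, with $\Phi h=\mathbb{E}h(Z)$, \[ |\mathbb{E}h(W_n)-\Phi h|\le \frac{\|h'\|}{\sqrt n}\sum_{i=1}^n|\epsilon_{i,1}|+\sum_{i=1}^n\sum_{k=1}^{p-1}\frac{N_k}{k!\,n^{(k+1)/2}}\,|k\epsilon_{i,k-1}-\epsilon_{i,k+1}|+\frac{N_p}{n^{(p+1)/2}}\sum_{i=1}^n\bigg(\frac{\mathbb{E}|X_i|^{p-1}}{(p-1)!}+\frac{\mathbb{E}|X_i|^{p+1}}{p!}\bigg),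 \] where, for $1\le k\le p$, \[ N_k=\min\bigg\{3\|h^{(k-1)}\|,\ \frac{\Gamma(\frac{k+1}{2})\,\|h^{(k)}\|}{\sqrt2\,\Gamma(\frac k2+1)},\ \frac{\|h^{(k+1)}\|}{k+1}\bigg\}. \] (For $p=1$ the double sum is empty and $\mathbb{E}|X_i|^{0}=1$.) -/

import Mathlib

open MeasureTheory ProbabilityTheory

noncomputable section

namespace SteinMoments

/-- The supremum norm `sup_x |f x|`; only used for bounded `f`. -/
def supNorm (f : ℝ → ℝ) : ℝ := ⨆ x : ℝ, |f x|

/-- `C_b^m(ℝ)`: bounded functions that are `m` times differentiable, with bounded derivatives of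
every order up to `m`. Continuity of the `m`-th derivative is not required, so for `m ≥ 1` this
contains every `m` times continuously differentiable function with bounded derivatives. -/
structure MemCb (m : ℕ) (h : ℝ → ℝ) : Prop where
  differentiable : ∀ k < m, Differentiable ℝ (iteratedDeriv k h)
  bounded : ∀ k ≤ m, ∃ C : ℝ, ∀ x : ℝ, |iteratedDeriv k h x| ≤ C

/-- `Φh = E h(Z)` for a standard normal `Z`. -/
def normalMean (h : ℝ → ℝ) : ℝ := ∫ z, h z ∂(gaussianReal 0 1)

/-- The moment mismatch `E Y^k - E Z^k`, with `Z` standard normal. -/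
def momentDiff {Ω : Type*} [MeasurableSpace Ω] (μ : Measure Ω) (Y : Ω → ℝ) (k : ℕ) : ℝ :=
  (∫ ω, Y ω ^ k ∂μ) - ∫ z, z ^ k ∂(gaussianReal 0 1)

/-- The constant `N_k`, for `k ≥ 1`. -/
def steinConst (h : ℝ → ℝ) (k : ℕ) : ℝ :=
  min (3 * supNorm (iteratedDeriv (k - 1) h))
    (min (Real.Gamma (((k : ℝ) + 1) / 2) * supNorm (iteratedDeriv k h)
        / (Real.sqrt 2 * Real.Gamma ((k : ℝ) / 2 + 1)))
      (supNorm (iteratedDeriv (k + 1) h) / ((k : ℝ) + 1)))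

/-- The standardised sum `W_n = n^{-1/2} (X_1 + ⋯ + X_n)`. -/
def stdSum {Ω : Type*} {n : ℕ} (X : Fin n → Ω → ℝ) (ω : Ω) : ℝ :=
  (1 / Real.sqrt (n : ℝ)) * ∑ i, X i ω

end SteinMoments

end

/-!
Let `f` solve Stein's equation `f'(x) - x f(x) = h(x) - Φh`, so that `E h(W) - Φh` equals
`E[f'(W) - W f(W)]`. Integrating the Ornstein–Uhlenbeck semigroup gives
`f⁽ᵏ⁾(x) = -∫₀¹ uᵏ E h⁽ᵏ⁺¹⁾(u x + √(1 - u²) Z) du`, which bounds `f⁽ᵏ⁾` by `‖h⁽ᵏ⁺¹⁾‖ / (k + 1)`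
and, after one Gaussian integration by parts, by the multiple of `‖h⁽ᵏ⁾‖` with the Gamma functions.
The bound `‖f⁽ᵏ⁾‖ ≤ 2 ‖h⁽ᵏ⁻¹⁾‖` comes from the differential equation `v' = x v + A + g`, with `A'` a
nonnegative multiple of `v`, that `v = f⁽ᵏ⁻¹⁾` satisfies for `g = h⁽ᵏ⁻¹⁾`: along a bounded solution
`x v + A` cannot exceed a common bound of `A` and `g`.

With `s = 1 / √n`, `E[f'(W) - W f(W)]` is the sum over `i` of `E[s² f'(W) - s Xᵢ f(W)]`. Writing
`W = U + s Xᵢ` with `U` independent of `Xᵢ` and expanding in `s`, the coefficient of `s^(k+1) / k!`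
is `E f⁽ᵏ⁾(U) · E[k Xᵢ^(k-1) - Xᵢ^(k+1)]`; the second factor vanishes for `Z` in place of `Xᵢ`, so
it is a combination of moment differences.
-/

namespace SteinMoments

open Set Real
open scoped NNReal Nat

section RealAnalysis

lemma not_bddAbove_range_of_le_hasDerivAt {v v' : ℝ → ℝ} {a c : ℝ} (hc : 0 < c)
    (hv : ∀ x, HasDerivAt v (v' x) x) (hv' : ∀ x, a ≤ x → c ≤ v' x) : ¬ BddAbove (range v) := by
  rintro ⟨C, hC⟩
  have hCv (x : ℝ) : v x ≤ C := hC (mem_range_self x)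
  have hgrowth := (convex_Ici a).mul_sub_le_image_sub_of_le_deriv (f := v) (C := c)
    (fun x _ ↦ (hv x).continuousAt.continuousWithinAt)
    (fun x _ ↦ (hv x).differentiableAt.differentiableWithinAt)
    (fun x hx ↦ by rw [(hv x).deriv]; exact hv' x (interior_subset hx))
  have hva : 0 < C - v a + 1 := by linarith [hCv a]
  have hstep : a ≤ a + (C - v a + 1) / c := by linarith [div_pos hva hc]
  have := hgrowth a self_mem_Ici _ hstep hstep
  rw [add_sub_cancel_left, mul_div_cancel₀ _ hc.ne'] at this
  linarith [hCv (a + (C - v a + 1) / c)]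

/- If `H = x v + A` exceeded `M` at `a ≥ 0`, it could never return to its value there: at such a
point `x > 0` and `v > 0`, so `H' = x (H + g) + (m + 1) v > 0`. Then `v' = H + g` would stay bounded
away from zero, contradicting the boundedness of `v`. -/
lemma mul_add_le_of_nonneg {v A g : ℝ → ℝ} {m M a : ℝ} (hm : 0 ≤ m)
    (hv : ∀ x, HasDerivAt v (x * v x + A x + g x) x) (hA : ∀ x, HasDerivAt A (m * v x) x)
    (hAM : ∀ x, A x ≤ M) (hgM : ∀ x, -M ≤ g x) (hvb : BddAbove (range v)) (ha : 0 ≤ a) :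
    a * v a + A a ≤ M := by
  by_contra! hlt
  have hH (x : ℝ) : HasDerivAt (fun y ↦ y * v y + A y)
      (x * (x * v x + A x + g x) + (m + 1) * v x) x := by
    convert! ((hasDerivAt_id x).mul (hv x)).add (hA x) using 1
    simp only [id_eq]
    ring
  have hstay (x : ℝ) (hx : a ≤ x) : a * v a + A a ≤ x * v x + A x := by
    refine image_le_of_deriv_right_lt_deriv_boundary (a := a) (b := x) continuousOn_const
      (fun y _ ↦ hasDerivWithinAt_const y _ _) le_rfl hH (fun y hy heq ↦ ?_) (right_mem_Icc.2 hx)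
    have hyv : 0 < y * v y := by linarith [hAM y]
    have hy0 : 0 ≤ y := ha.trans hy.1
    have hvy : 0 < v y := pos_of_mul_pos_right hyv hy0
    have hHg : 0 ≤ y * v y + A y + g y := by linarith [hgM y]
    positivity
  exact not_bddAbove_range_of_le_hasDerivAt (sub_pos.2 hlt) hv
    (fun x hx ↦ by linarith [hstay x hx, hgM x]) hvb

lemma mul_add_le {v A g : ℝ → ℝ} {m M : ℝ} (hm : 0 ≤ m)
    (hv : ∀ x, HasDerivAt v (x * v x + A x + g x) x) (hA : ∀ x, HasDerivAt A (m * v x) x)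
    (hAM : ∀ x, A x ≤ M) (hgM : ∀ x, -M ≤ g x) {C : ℝ} (hvC : ∀ x, |v x| ≤ C) (a : ℝ) :
    a * v a + A a ≤ M := by
  rcases le_total 0 a with ha | ha
  · exact mul_add_le_of_nonneg hm hv hA hAM hgM
      ⟨C, forall_mem_range.2 fun x ↦ (abs_le.1 (hvC x)).2⟩ ha
  · have := mul_add_le_of_nonneg (v := fun x ↦ -v (-x)) (A := fun x ↦ A (-x))
      (g := fun x ↦ g (-x)) hm
      (fun x ↦ by convert! ((hv (-x)).comp x (hasDerivAt_neg x)).neg using 1; ring)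
      (fun x ↦ by convert! (hA (-x)).comp x (hasDerivAt_neg x) using 1; ring)
      (fun x ↦ hAM (-x)) (fun x ↦ hgM (-x))
      ⟨C, forall_mem_range.2 fun x ↦ by linarith [(abs_le.1 (hvC (-x))).1]⟩ (neg_nonneg.2 ha)
    simpa using this

lemma abs_mul_add_add_le {v A g : ℝ → ℝ} {m M C : ℝ} (hm : 0 ≤ m)
    (hv : ∀ x, HasDerivAt v (x * v x + A x + g x) x) (hA : ∀ x, HasDerivAt A (m * v x) x)
    (hAM : ∀ x, |A x| ≤ M) (hgM : ∀ x, |g x| ≤ M) (hvC : ∀ x, |v x| ≤ C) (a : ℝ) :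
    |a * v a + A a + g a| ≤ 2 * M := by
  have hupper := mul_add_le hm hv hA (fun x ↦ (abs_le.1 (hAM x)).2)
    (fun x ↦ (abs_le.1 (hgM x)).1) hvC a
  have hlower := mul_add_le (v := fun x ↦ -v x) (A := fun x ↦ -A x) (g := fun x ↦ -g x) hm
    (fun x ↦ by convert! (hv x).neg using 1; ring)
    (fun x ↦ by convert! (hA x).neg using 1; ring)
    (fun x ↦ by linarith [(abs_le.1 (hAM x)).1]) (fun x ↦ neg_le_neg (abs_le.1 (hgM x)).2)
    (fun x ↦ by simpa using hvC x) a
  have hg := abs_le.1 (hgM a)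
  exact abs_le.2 ⟨by linarith, by linarith⟩

lemma exists_eq_taylor_add_lagrange {f : ℝ → ℝ} {m : ℕ}
    (hf : ∀ k < m, Differentiable ℝ (iteratedDeriv k f)) (w t : ℝ) :
    ∃ ξ, f (w + t) = (∑ k ∈ Finset.range m, iteratedDeriv k f w * t ^ k / k !)
      + iteratedDeriv m f ξ * t ^ m / m ! := by
  rcases m with _ | n
  · exact ⟨w + t, by simp⟩
  rcases eq_or_ne t 0 with rfl | ht
  · exact ⟨w, by simp [Finset.sum_range_succ']⟩
  have hne : w ≠ w + t := by simpa [eq_comm] using ht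
  have hs : UniqueDiffOn ℝ (uIcc w (w + t)) := uniqueDiffOn_uIcc hne
  have hcont : ContDiff ℝ n f :=
    contDiff_of_differentiable_iteratedDeriv fun k hk ↦
      hf k (Nat.lt_succ_of_le (by exact_mod_cast hk))
  have hwithin {k : ℕ} (hk : k ≤ n) :
      EqOn (iteratedDerivWithin k f (uIcc w (w + t))) (iteratedDeriv k f) (uIcc w (w + t)) :=
    fun x hx ↦ iteratedDerivWithin_eq_iteratedDeriv hs
      (hcont.contDiffAt.of_le (by exact_mod_cast hk)) hx
  obtain ⟨ξ, hξ, hlag⟩ := taylor_mean_remainder_lagrange hne hcont.contDiffOn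
    (((hf n n.lt_succ_self).differentiableOn.congr (hwithin le_rfl)).mono Ioo_subset_Icc_self)
  have hξ' : ξ ∈ uIcc w (w + t) := Ioo_subset_Icc_self hξ
  have htop : iteratedDerivWithin (n + 1) f (uIcc w (w + t)) ξ = iteratedDeriv (n + 1) f ξ := by
    rw [iteratedDerivWithin_succ, derivWithin_congr (hwithin le_rfl) (hwithin le_rfl hξ'),
      (hf n n.lt_succ_self ξ).derivWithin (hs ξ hξ'), iteratedDeriv_succ]
  refine ⟨ξ, ?_⟩
  rw [sub_eq_iff_eq_add', htop, taylor_within_apply, add_sub_cancel_left] at hlag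
  rw [hlag]
  congr 1
  refine Finset.sum_congr rfl fun k hk ↦ ?_
  rw [hwithin (Nat.lt_succ_iff.1 (Finset.mem_range.1 hk)) left_mem_uIcc, smul_eq_mul]
  ring

lemma measurable_iteratedDeriv {f : ℝ → ℝ} (hf : Measurable f) (k : ℕ) :
    Measurable (iteratedDeriv k f) := by
  cases k with
  | zero => simpa
  | succ k => rw [iteratedDeriv_succ]; exact measurable_deriv _

lemma integral_sin_pow_zero_pi_div_two (m : ℕ) :
    ∫ θ in 0..(π / 2), sin θ ^ m = √π / 2 * (Gamma ((m + 1) / 2) / Gamma (m / 2 + 1)) := by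
  induction m using Nat.twoStepInduction with
  | zero =>
    have hΓ : Gamma 2⁻¹ = √π := by rw [← Gamma_one_half_eq, one_div]
    simp [hΓ, div_mul_eq_mul_div, mul_self_sqrt pi_pos.le]
  | one =>
    have hΓ : Gamma (3 / 2) = √π / 2 := by
      rw [show (3 / 2 : ℝ) = 1 / 2 + 1 by norm_num, Gamma_add_one (by norm_num), Gamma_one_half_eq]
      ring
    have : √π ≠ 0 := by positivity
    norm_num [hΓ]
    field_simp
  | more m ih _ =>
    have hΓ_num : Gamma (((m + 2 : ℕ) + 1) / 2) = (m + 1) / 2 * Gamma ((m + 1) / 2) := by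
      rw [← Gamma_add_one (by positivity)]; congr 1; push_cast; ring
    have hΓ_den : Gamma ((m + 2 : ℕ) / 2 + 1) = (m / 2 + 1) * Gamma (m / 2 + 1) := by
      rw [← Gamma_add_one (by positivity)]; congr 1; push_cast; ring
    have : 0 < Gamma ((m : ℝ) / 2 + 1) := Gamma_pos_of_pos (by positivity)
    rw [integral_sin_pow, ih, hΓ_num, hΓ_den, sin_zero, cos_pi_div_two, zero_pow (by lia)]
    field_simp
    ring

lemma integral_sin_pow_mul_cos (m : ℕ) :
    ∫ θ in 0..(π / 2), sin θ ^ m * cos θ = 1 / ((m : ℝ) + 1) := by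
  have := integral_sin_pow_mul_cos_pow_odd (a := 0) (b := π / 2) m 0
  simpa using this

end RealAnalysis

section Gaussian

variable {m : ℝ} {v : ℝ≥0}

lemma integrable_gaussianReal_iff {f : ℝ → ℝ} (hv : v ≠ 0) :
    Integrable f (gaussianReal m v) ↔ Integrable (fun x ↦ gaussianPDFReal m v x * f x) := by
  rw [gaussianReal_of_var_ne_zero _ hv, integrable_withDensity_iff_integrable_smul'
    (measurable_gaussianPDF _ _) (ae_of_all _ fun _ ↦ gaussianPDF_lt_top)]
  simp only [toReal_gaussianPDF, smul_eq_mul]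

lemma hasDerivAt_gaussianPDFReal (m : ℝ) (v : ℝ≥0) (x : ℝ) :
    HasDerivAt (gaussianPDFReal m v) (-((x - m) / v * gaussianPDFReal m v x)) x := by
  have hexponent : HasDerivAt (fun y ↦ -(y - m) ^ 2 / (2 * v)) (-((x - m) / v)) x := by
    convert! ((((hasDerivAt_id x).sub_const m).pow 2).neg).div_const (2 * (v : ℝ)) using 1
    simp only [id_eq]
    ring
  convert! hexponent.exp.const_mul (√(2 * π * v))⁻¹ using 1
  rw [gaussianPDFReal]
  ring

lemma integral_sub_mul_gaussianReal {g g' : ℝ → ℝ} (hg : ∀ x, HasDerivAt g (g' x) x)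
    (hint : Integrable g (gaussianReal m v))
    (hint_mul : Integrable (fun x ↦ (x - m) * g x) (gaussianReal m v))
    (hint' : Integrable g' (gaussianReal m v)) :
    ∫ x, (x - m) * g x ∂gaussianReal m v = v * ∫ x, g' x ∂gaussianReal m v := by
  rcases eq_or_ne v 0 with rfl | hv
  · simp [gaussianReal_zero_var]
  have hv' : (v : ℝ) ≠ 0 := by exact_mod_cast hv
  rw [integrable_gaussianReal_iff hv] at hint hint_mul hint'
  have hparts := integral_mul_deriv_eq_deriv_mul_of_integrable (u := g) (v := gaussianPDFReal m v)
    (fun x _ ↦ hg x) (fun x _ ↦ hasDerivAt_gaussianPDFReal m v x)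
    (by convert! (hint_mul.const_mul (v : ℝ)⁻¹).neg using 1; ext x
        simp only [Pi.neg_apply, Pi.mul_apply]; ring)
    (by convert! hint' using 1; ext x; simp [mul_comm])
    (by convert! hint using 1; ext x; simp [mul_comm])
  rw [integral_gaussianReal_eq_integral_smul hv, integral_gaussianReal_eq_integral_smul hv]
  calc ∫ x, gaussianPDFReal m v x • ((x - m) * g x)
      = -(v * ∫ x, g x * -((x - m) / v * gaussianPDFReal m v x)) := by
        rw [← integral_const_mul, ← integral_neg]
        congr 1 with x
        rw [smul_eq_mul]
        field_simp
    _ = v * ∫ x, gaussianPDFReal m v x • g' x := by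
        rw [hparts, mul_neg, neg_neg]
        simp only [smul_eq_mul, mul_comm]

lemma integrable_sub_pow_gaussianReal (k : ℕ) :
    Integrable (fun x ↦ (x - m) ^ k) (gaussianReal m v) := by
  refine (integrable_norm_iff (by fun_prop)).1 ?_
  simpa using ((memLp_id_gaussianReal (μ := m) (v := v) (k : ℝ≥0)).sub
    (memLp_const m)).integrable_norm_pow'

lemma integral_sub_pow_add_two_gaussianReal (k : ℕ) :
    ∫ x, (x - m) ^ (k + 2) ∂gaussianReal m v
      = v * ((k + 1) * ∫ x, (x - m) ^ k ∂gaussianReal m v) := by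
  have hderiv (x : ℝ) : HasDerivAt (fun y ↦ (y - m) ^ (k + 1)) ((k + 1) * (x - m) ^ k) x := by
    simpa using ((hasDerivAt_id' x).sub_const m).fun_pow (k + 1)
  have := integral_sub_mul_gaussianReal (m := m) (v := v) hderiv (integrable_sub_pow_gaussianReal _)
    (by simpa only [← pow_succ'] using integrable_sub_pow_gaussianReal (k + 2))
    ((integrable_sub_pow_gaussianReal k).const_mul _)
  rw [integral_const_mul] at this
  simpa only [← pow_succ'] using this

lemma integral_abs_sub_gaussianReal : ∫ x, |x - m| ∂gaussianReal m v = √(2 * v / π) := by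
  rcases eq_or_ne v 0 with rfl | hv
  · simp [gaussianReal_zero_var]
  have : (0 : ℝ) < v := by exact_mod_cast pos_iff_ne_zero.2 hv
  have hhalf : ∫ x in Ioi (0 : ℝ), exp (-x ^ 2 / (2 * v)) * x = v := by
    have := integral_rpow_mul_exp_neg_mul_rpow (p := 2) (q := 1) (b := (2 * (v : ℝ))⁻¹)
      two_pos (by norm_num) (by positivity)
    norm_num [rpow_neg_one] at this
    convert this using 1
    · congr 1 with x
      ring_nf
    · ring
  calc ∫ x, |x - m| ∂gaussianReal m v
      = ∫ x, (√(2 * π * v))⁻¹ * (exp (-|x - m| ^ 2 / (2 * v)) * |x - m|) := by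
        rw [integral_gaussianReal_eq_integral_smul hv]
        simp only [gaussianPDFReal, smul_eq_mul, sq_abs, mul_assoc]
    _ = (√(2 * π * v))⁻¹ * (2 * v) := by
        rw [integral_const_mul,
          integral_sub_right_eq_self (fun x ↦ exp (-|x| ^ 2 / (2 * v)) * |x|) m,
          integral_comp_abs (f := fun x ↦ exp (-x ^ 2 / (2 * v)) * x), hhalf]
    _ = √(2 * v / π) := by
        rw [eq_comm, sqrt_eq_iff_eq_sq (by positivity) (by positivity), mul_pow, inv_pow,
          sq_sqrt (by positivity)]
        field_simp

end Gaussian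

section Mehler

variable {g : ℝ → ℝ} {C C' : ℝ}

lemma hasDerivAt_integral_comp_affine {ν : Measure ℝ} [IsFiniteMeasure ν]
    (hν : Integrable (fun z ↦ z) ν) {a a' b b' : ℝ → ℝ} {A B : ℝ}
    (ha : ∀ t, HasDerivAt a (a' t) t) (hb : ∀ t, HasDerivAt b (b' t) t)
    (hA : ∀ t, |a' t| ≤ A) (hB : ∀ t, |b' t| ≤ B)
    (hg : Differentiable ℝ g) (hC : ∀ x, |g x| ≤ C) (hC' : ∀ x, |deriv g x| ≤ C') (t : ℝ) :
    HasDerivAt (fun t ↦ ∫ z, g (a t + b t * z) ∂ν)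
      (∫ z, (a' t + b' t * z) * deriv g (a t + b t * z) ∂ν) t := by
  have : 0 ≤ C' := (abs_nonneg _).trans (hC' 0)
  have hmeas (t : ℝ) : AEStronglyMeasurable (fun z ↦ g (a t + b t * z)) ν :=
    (hg.continuous.comp (by fun_prop)).aestronglyMeasurable
  have hmeas' : Measurable (fun z ↦ deriv g (a t + b t * z)) :=
    (measurable_deriv g).comp (by fun_prop)
  refine (hasDerivAt_integral_of_dominated_loc_of_deriv_le (s := univ)
    (bound := fun z ↦ (A + B * |z|) * C') Filter.univ_mem
    (.of_forall hmeas) (.of_bound (hmeas t) C (ae_of_all _ fun z ↦ hC _))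
    (F' := fun t z ↦ (a' t + b' t * z) * deriv g (a t + b t * z))
    (Measurable.mul (by fun_prop) hmeas').aestronglyMeasurable
    (ae_of_all _ fun z s _ ↦ ?_) (((integrable_const A).add (hν.abs.const_mul B)).mul_const C')
    (ae_of_all _ fun z s _ ↦ ?_)).2
  · calc ‖(a' s + b' s * z) * deriv g (a s + b s * z)‖
        = |a' s + b' s * z| * |deriv g (a s + b s * z)| := by rw [norm_eq_abs, abs_mul]
      _ ≤ (|a' s| + |b' s| * |z|) * |deriv g (a s + b s * z)| := by
        gcongr
        exact (abs_add_le _ _).trans_eq (by rw [abs_mul])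
      _ ≤ (A + B * |z|) * C' := by
        have := (abs_nonneg _).trans (hA s)
        have := (abs_nonneg _).trans (hB s)
        gcongr ?_ * ?_
        · gcongr
          exacts [hA s, hB s]
        · exact hC' _
  · rw [mul_comm]
    exact (hg _).hasDerivAt.comp s ((ha s).add ((hb s).mul_const z))

lemma integrable_mul_comp_affine (hg : Measurable g) (hC : ∀ x, |g x| ≤ C) (a b : ℝ) :
    Integrable (fun z ↦ z * g (a + b * z)) (gaussianReal 0 1) :=
  Integrable.mul_bdd (c := C) (by simpa using integrable_sub_pow_gaussianReal (m := 0) 1)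
    (hg.comp (by fun_prop)).aestronglyMeasurable (ae_of_all _ fun z ↦ hC _)

lemma mul_integral_deriv_comp_affine (hg : Differentiable ℝ g) (hC : ∀ x, |g x| ≤ C)
    (hC' : ∀ x, |deriv g x| ≤ C') (a b : ℝ) :
    b * ∫ z, deriv g (a + b * z) ∂gaussianReal 0 1
      = ∫ z, z * g (a + b * z) ∂gaussianReal 0 1 := by
  have hderiv (z : ℝ) : HasDerivAt (fun z ↦ g (a + b * z)) (b * deriv g (a + b * z)) z := by
    rw [mul_comm]
    exact (hg _).hasDerivAt.comp z (by simpa using ((hasDerivAt_id z).const_mul b).const_add a)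
  have hmeas := (measurable_deriv g).comp (f := fun z ↦ a + b * z) (by fun_prop)
  have := integral_sub_mul_gaussianReal (m := 0) (v := 1) hderiv
    (.of_bound (hg.continuous.comp (by fun_prop)).aestronglyMeasurable C
      (ae_of_all _ fun z ↦ hC _))
    (by simpa using integrable_mul_comp_affine hg.continuous.measurable hC a b)
    ((Integrable.of_bound hmeas.aestronglyMeasurable C' (ae_of_all _ fun z ↦ hC' _)).const_mul b)
  simpa [integral_const_mul] using this.symm

lemma abs_mul_integral_deriv_comp_affine_le (hg : Differentiable ℝ g) (hC : ∀ x, |g x| ≤ C)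
    (hC' : ∀ x, |deriv g x| ≤ C') (a b : ℝ) :
    |b * ∫ z, deriv g (a + b * z) ∂gaussianReal 0 1| ≤ √(2 / π) * C := by
  have habs : Integrable (fun z : ℝ ↦ |z|) (gaussianReal 0 1) := by
    simpa using (integrable_sub_pow_gaussianReal (m := 0) (v := 1) 1).abs
  calc |b * ∫ z, deriv g (a + b * z) ∂gaussianReal 0 1|
      = |∫ z, z * g (a + b * z) ∂gaussianReal 0 1| := by
        rw [mul_integral_deriv_comp_affine hg hC hC']
    _ ≤ ∫ z, |z| * C ∂gaussianReal 0 1 := by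
        refine norm_integral_le_of_norm_le (f := fun z ↦ z * g (a + b * z)) (habs.mul_const C)
          (ae_of_all _ fun z ↦ ?_)
        rw [norm_mul]
        gcongr
        exacts [le_rfl, hC _]
    _ = √(2 / π) * C := by
        have := integral_abs_sub_gaussianReal (m := 0) (v := 1)
        rw [integral_mul_const]
        simp_all

/-- The Ornstein–Uhlenbeck semigroup in Mehler's form,
`P_t g (x) = E g(e^{-t} x + √(1 - e^{-2t}) Z)` with `Z` standard normal, parametrised by the angle
`θ` with `sin θ = e^{-t}`. -/
noncomputable def mehler (g : ℝ → ℝ) (θ x : ℝ) : ℝ :=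
  ∫ z, g (sin θ * x + cos θ * z) ∂gaussianReal 0 1

/-- The integral `∫₀¹ u^m E g(u x + √(1 - u²) Z) du`, with `Z` standard normal, written with
`u = sin θ`; the derivatives of the solution of Stein's equation are of this form. -/
noncomputable def mehlerAverage (m : ℕ) (g : ℝ → ℝ) (x : ℝ) : ℝ :=
  ∫ θ in 0..(π / 2), sin θ ^ m * cos θ * mehler g θ x

lemma measurable_mehler (hg : Measurable g) (x : ℝ) : Measurable (fun θ ↦ mehler g θ x) :=
  (StronglyMeasurable.integral_prod_right' (ν := gaussianReal 0 1)
    (f := fun q : ℝ × ℝ ↦ g (sin q.1 * x + cos q.1 * q.2))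
    (hg.comp (by fun_prop)).stronglyMeasurable).measurable

lemma abs_mehler_le (hC : ∀ x, |g x| ≤ C) (θ x : ℝ) : |mehler g θ x| ≤ C := by
  simpa [mehler] using norm_integral_le_of_norm_le_const (μ := gaussianReal 0 1)
    (f := fun z ↦ g (sin θ * x + cos θ * z)) (ae_of_all _ fun z ↦ hC (sin θ * x + cos θ * z))

lemma intervalIntegrable_mul_mehler (hg : Measurable g) (hC : ∀ x, |g x| ≤ C)
    {w : ℝ → ℝ} (hw : Continuous w) (x : ℝ) :
    IntervalIntegrable (fun θ ↦ w θ * mehler g θ x) volume 0 (π / 2) :=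
  intervalIntegrable_iff.2 <| (hw.intervalIntegrable 0 (π / 2)).def'.mul_bdd
    (measurable_mehler hg x).aestronglyMeasurable (ae_of_all _ fun θ ↦ abs_mehler_le hC θ x)

lemma hasDerivAt_mehler (hg : Differentiable ℝ g) (hC : ∀ x, |g x| ≤ C)
    (hC' : ∀ x, |deriv g x| ≤ C') (θ x : ℝ) :
    HasDerivAt (mehler g θ) (sin θ * mehler (deriv g) θ x) x := by
  convert! hasDerivAt_integral_comp_affine (ν := gaussianReal 0 1) (a := fun x ↦ sin θ * x)
    (by simpa using integrable_sub_pow_gaussianReal (m := 0) 1)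
    (fun t ↦ (hasDerivAt_id' t).const_mul (sin θ)) (fun t ↦ hasDerivAt_const t (cos θ))
    (fun _ ↦ le_rfl) (fun _ ↦ le_rfl) hg hC hC' x using 1
  simp [mehler, integral_const_mul]

lemma hasDerivAt_mehler_angle (hg : Differentiable ℝ g) (hg' : Differentiable ℝ (deriv g))
    (hC : ∀ x, |g x| ≤ C) (hC' : ∀ x, |deriv g x| ≤ C') {C'' : ℝ}
    (hC'' : ∀ x, |deriv (deriv g) x| ≤ C'') (θ x : ℝ) :
    HasDerivAt (fun θ ↦ mehler g θ x)
      (x * (cos θ * mehler (deriv g) θ x) - sin θ * cos θ * mehler (deriv (deriv g)) θ x) θ := by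
  have hint : Integrable (fun z ↦ deriv g (sin θ * x + cos θ * z)) (gaussianReal 0 1) :=
    .of_bound (hg'.continuous.comp (by fun_prop)).aestronglyMeasurable C'
      (ae_of_all _ fun z ↦ hC' _)
  convert! hasDerivAt_integral_comp_affine (ν := gaussianReal 0 1)
    (by simpa using integrable_sub_pow_gaussianReal (m := 0) 1)
    (fun t ↦ (hasDerivAt_sin t).mul_const x) hasDerivAt_cos
    (fun t ↦ by rw [abs_mul]; exact mul_le_of_le_one_left (abs_nonneg x) (abs_cos_le_one t))
    (fun t ↦ by simpa using abs_sin_le_one t) hg hC hC' θ using 1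
  calc x * (cos θ * mehler (deriv g) θ x) - sin θ * cos θ * mehler (deriv (deriv g)) θ x
      = cos θ * x * mehler (deriv g) θ x
        - sin θ * ∫ z, z * deriv g (sin θ * x + cos θ * z) ∂gaussianReal 0 1 := by
        rw [← mul_integral_deriv_comp_affine hg' hC' hC'', mehler, mehler]
        ring
    _ = ∫ z, (cos θ * x * deriv g (sin θ * x + cos θ * z)
          - sin θ * (z * deriv g (sin θ * x + cos θ * z))) ∂gaussianReal 0 1 := by
        rw [integral_sub (hint.const_mul _)
          ((integrable_mul_comp_affine hg'.continuous.measurable hC' _ _).const_mul _),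
          integral_const_mul, integral_const_mul, mehler]
    _ = ∫ z, (cos θ * x + -sin θ * z) * deriv g (sin θ * x + cos θ * z) ∂gaussianReal 0 1 := by
        congr 1 with z
        ring

lemma hasDerivAt_mehlerAverage (m : ℕ) (hg : Differentiable ℝ g) (hC : ∀ x, |g x| ≤ C)
    (hC' : ∀ x, |deriv g x| ≤ C') (x : ℝ) :
    HasDerivAt (mehlerAverage m g) (mehlerAverage (m + 1) (deriv g) x) x := by
  have hmeas (x : ℝ) : AEStronglyMeasurable (fun θ ↦ sin θ ^ m * cos θ * mehler g θ x)
      (volume.restrict (uIoc 0 (π / 2))) :=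
    (intervalIntegrable_mul_mehler hg.continuous.measurable hC (by fun_prop)
      x).def'.aestronglyMeasurable
  have hmeas' : AEStronglyMeasurable (fun θ ↦ sin θ ^ (m + 1) * cos θ * mehler (deriv g) θ x)
      (volume.restrict (uIoc 0 (π / 2))) :=
    (intervalIntegrable_mul_mehler (measurable_deriv g) hC' (by fun_prop)
      x).def'.aestronglyMeasurable
  refine (intervalIntegral.hasDerivAt_integral_of_dominated_loc_of_deriv_le (s := univ)
    (F' := fun x θ ↦ sin θ ^ (m + 1) * cos θ * mehler (deriv g) θ x) (bound := fun _ ↦ C')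
    Filter.univ_mem (.of_forall hmeas)
    (intervalIntegrable_mul_mehler hg.continuous.measurable hC (by fun_prop) x) hmeas'
    (ae_of_all _ fun θ _ y _ ↦ ?_) intervalIntegrable_const (ae_of_all _ fun θ _ y _ ↦ ?_)).2
  · rw [norm_eq_abs, abs_mul, abs_mul, abs_pow]
    calc |sin θ| ^ (m + 1) * |cos θ| * |mehler (deriv g) θ y| ≤ 1 ^ (m + 1) * 1 * C' := by
          gcongr
          exacts [abs_sin_le_one θ, abs_cos_le_one θ, abs_mehler_le hC' θ y]
      _ = C' := by ring
  · convert! (hasDerivAt_mehler hg hC hC' θ y).const_mul (sin θ ^ m * cos θ) using 1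
    ring

lemma mul_mehlerAverage_sub_mehlerAverage (hg : Differentiable ℝ g)
    (hg' : Differentiable ℝ (deriv g)) (hC : ∀ x, |g x| ≤ C) (hC' : ∀ x, |deriv g x| ≤ C')
    {C'' : ℝ} (hC'' : ∀ x, |deriv (deriv g) x| ≤ C'') (x : ℝ) :
    x * mehlerAverage 0 (deriv g) x - mehlerAverage 1 (deriv (deriv g)) x
      = g x - normalMean g := by
  have hint' := intervalIntegrable_mul_mehler (measurable_deriv g) hC' continuous_cos x
  have hint'' := intervalIntegrable_mul_mehler (w := fun θ ↦ sin θ * cos θ)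
    (measurable_deriv (deriv g)) hC'' (by fun_prop) x
  calc x * mehlerAverage 0 (deriv g) x - mehlerAverage 1 (deriv (deriv g)) x
      = ∫ θ in 0..(π / 2), (x * (cos θ * mehler (deriv g) θ x)
          - sin θ * cos θ * mehler (deriv (deriv g)) θ x) := by
        rw [intervalIntegral.integral_sub (hint'.const_mul x) hint'',
          intervalIntegral.integral_const_mul]
        simp only [mehlerAverage, pow_zero, one_mul, pow_one]
    _ = mehler g (π / 2) x - mehler g 0 x :=
        intervalIntegral.integral_eq_sub_of_hasDerivAt
          (fun θ _ ↦ hasDerivAt_mehler_angle hg hg' hC hC' hC'' θ x)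
          ((hint'.const_mul x).sub hint'')
    _ = g x - normalMean g := by simp [mehler, normalMean]

lemma abs_mehlerAverage_le_integral (m : ℕ) {b : ℝ → ℝ} (hb : Continuous b) {x : ℝ}
    (hgb : ∀ θ, 0 ≤ cos θ → |cos θ * mehler g θ x| ≤ b θ) :
    |mehlerAverage m g x| ≤ ∫ θ in 0..(π / 2), sin θ ^ m * b θ := by
  have hint : IntervalIntegrable (fun θ ↦ sin θ ^ m * b θ) volume 0 (π / 2) :=
    Continuous.intervalIntegrable (by fun_prop) _ _
  rw [mehlerAverage, ← norm_eq_abs]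
  refine intervalIntegral.norm_integral_le_of_norm_le pi_div_two_pos.le (ae_of_all _ fun θ hθ ↦ ?_)
    hint
  have hsin : 0 ≤ sin θ := sin_nonneg_of_nonneg_of_le_pi hθ.1.le (by linarith [hθ.2, pi_pos])
  have hcos : 0 ≤ cos θ := cos_nonneg_of_mem_Icc ⟨by linarith [hθ.1, pi_pos], hθ.2⟩
  rw [norm_eq_abs, mul_assoc, abs_mul, abs_of_nonneg (pow_nonneg hsin m)]
  gcongr
  exact hgb θ hcos

lemma abs_mehlerAverage_le (m : ℕ) (hC : ∀ x, |g x| ≤ C) (x : ℝ) :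
    |mehlerAverage m g x| ≤ C / (m + 1) := by
  calc |mehlerAverage m g x| ≤ ∫ θ in 0..(π / 2), sin θ ^ m * (cos θ * C) := by
        refine abs_mehlerAverage_le_integral m (by fun_prop) fun θ hθ ↦ ?_
        rw [abs_mul, abs_of_nonneg hθ]
        gcongr
        exact abs_mehler_le hC θ x
    _ = C / (m + 1) := by
        simp only [← mul_assoc, intervalIntegral.integral_mul_const, integral_sin_pow_mul_cos]
        ring

lemma abs_mehlerAverage_deriv_le (m : ℕ) (hg : Differentiable ℝ g) (hC : ∀ x, |g x| ≤ C)
    (hC' : ∀ x, |deriv g x| ≤ C') (x : ℝ) :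
    |mehlerAverage m (deriv g) x|
      ≤ Gamma ((m + 1) / 2) * C / (√2 * Gamma (m / 2 + 1)) := by
  calc |mehlerAverage m (deriv g) x| ≤ ∫ θ in 0..(π / 2), sin θ ^ m * (√(2 / π) * C) :=
        abs_mehlerAverage_le_integral m continuous_const fun θ _ ↦
          abs_mul_integral_deriv_comp_affine_le hg hC hC' _ _
    _ = Gamma ((m + 1) / 2) * C / (√2 * Gamma (m / 2 + 1)) := by
        have hsqrt : √2 * √2 = 2 := mul_self_sqrt zero_le_two
        have : Gamma ((m : ℝ) / 2 + 1) ≠ 0 := (Gamma_pos_of_pos (by positivity)).ne'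
        rw [intervalIntegral.integral_mul_const, integral_sin_pow_zero_pi_div_two,
          sqrt_div zero_le_two]
        field_simp
        linear_combination C * hsqrt

end Mehler

section SteinSolution

variable {m p k : ℕ} {f h : ℝ → ℝ}

lemma supNorm_nonneg (f : ℝ → ℝ) : 0 ≤ supNorm f := iSup_nonneg fun _ ↦ abs_nonneg _

namespace MemCb

lemma mono (hf : MemCb m f) (hkm : k ≤ m) : MemCb k f :=
  ⟨fun j hj ↦ hf.differentiable j (hj.trans_le hkm), fun j hj ↦ hf.bounded j (hj.trans hkm)⟩

lemma deriv (hf : MemCb (m + 1) f) : MemCb m (deriv f) where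
  differentiable j hj := by
    simpa only [iteratedDeriv_succ'] using hf.differentiable (j + 1) (by lia)
  bounded j hj := by simpa only [iteratedDeriv_succ'] using hf.bounded (j + 1) (by lia)

lemma abs_iteratedDeriv_le (hf : MemCb m f) (hk : k ≤ m) (x : ℝ) :
    |iteratedDeriv k f x| ≤ supNorm (iteratedDeriv k f) :=
  le_ciSup (f := fun x ↦ |iteratedDeriv k f x|)
    ((hf.bounded k hk).imp fun _ hC ↦ forall_mem_range.2 hC) x

lemma abs_le (hf : MemCb m f) (x : ℝ) : |f x| ≤ supNorm f := by
  simpa only [iteratedDeriv_zero] using hf.abs_iteratedDeriv_le m.zero_le x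

lemma hasDerivAt (hf : MemCb m f) (hk : k < m) (x : ℝ) :
    HasDerivAt (iteratedDeriv k f) (iteratedDeriv (k + 1) f x) x := by
  rw [iteratedDeriv_succ]
  exact (hf.differentiable k hk x).hasDerivAt

lemma continuous (hf : MemCb (m + 1) f) : Continuous f := by
  simpa only [iteratedDeriv_zero] using (hf.differentiable 0 m.succ_pos).continuous

end MemCb

/-- The solution `f` of Stein's equation `f'(x) - x f(x) = h(x) - Φh` given by Mehler's formula. -/
noncomputable def steinSolution (h : ℝ → ℝ) (x : ℝ) : ℝ := -mehlerAverage 0 (deriv h) x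

lemma hasDerivAt_mehlerAverage_iteratedDeriv (hh : MemCb (k + 2) h) (x : ℝ) :
    HasDerivAt (mehlerAverage k (iteratedDeriv (k + 1) h))
      (mehlerAverage (k + 1) (iteratedDeriv (k + 2) h) x) x := by
  have hC' := hh.abs_iteratedDeriv_le (k := k + 2) le_rfl
  rw [iteratedDeriv_succ (n := k + 1)] at hC' ⊢
  exact hasDerivAt_mehlerAverage k (hh.differentiable (k + 1) (by lia))
    (hh.abs_iteratedDeriv_le (by lia)) hC' x

lemma iteratedDeriv_steinSolution (hh : MemCb (k + 1) h) :
    iteratedDeriv k (steinSolution h) = fun x ↦ -mehlerAverage k (iteratedDeriv (k + 1) h) x := by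
  induction k with
  | zero => simp [funext_iff, steinSolution]
  | succ k ih =>
    rw [iteratedDeriv_succ, ih (hh.mono (by lia))]
    exact funext fun x ↦ (hasDerivAt_mehlerAverage_iteratedDeriv hh x).neg.deriv

lemma abs_iteratedDeriv_steinSolution_le (hh : MemCb (k + 1) h) (x : ℝ) :
    |iteratedDeriv k (steinSolution h) x| ≤ supNorm (iteratedDeriv (k + 1) h) / (k + 1) := by
  rw [iteratedDeriv_steinSolution hh, abs_neg]
  exact abs_mehlerAverage_le k (hh.abs_iteratedDeriv_le le_rfl) x

lemma abs_iteratedDeriv_steinSolution_le_gamma (hh : MemCb (k + 1) h) (x : ℝ) :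
    |iteratedDeriv k (steinSolution h) x|
      ≤ Gamma ((k + 1) / 2) * supNorm (iteratedDeriv k h) / (√2 * Gamma (k / 2 + 1)) := by
  have hC' := hh.abs_iteratedDeriv_le le_rfl
  rw [iteratedDeriv_succ] at hC'
  rw [iteratedDeriv_steinSolution hh, abs_neg, iteratedDeriv_succ]
  exact abs_mehlerAverage_deriv_le k (hh.differentiable k (by lia))
    (hh.abs_iteratedDeriv_le (by lia)) hC' x

lemma memCb_steinSolution (hh : MemCb (p + 1) h) : MemCb p (steinSolution h) where
  differentiable k hk := by
    rw [iteratedDeriv_steinSolution (hh.mono (by lia))]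
    intro x
    exact (hasDerivAt_mehlerAverage_iteratedDeriv (hh.mono (by lia)) x).neg.differentiableAt
  bounded k hk := ⟨_, abs_iteratedDeriv_steinSolution_le (hh.mono (by lia))⟩

lemma deriv_steinSolution (hh : MemCb 2 h) (x : ℝ) :
    deriv (steinSolution h) x = x * steinSolution h x + (h x - normalMean h) := by
  have hderiv : deriv (steinSolution h) x = -mehlerAverage 1 (deriv (deriv h)) x := by
    simpa [iteratedDeriv_succ] using congrFun (iteratedDeriv_steinSolution (k := 1) hh) x
  have hh' : MemCb 1 (deriv h) := hh.deriv
  rw [hderiv, steinSolution, ← mul_mehlerAverage_sub_mehlerAverage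
    (by simpa using hh.differentiable 0 two_pos) (by simpa using hh'.differentiable 0 one_pos)
    hh.abs_le hh'.abs_le (hh'.deriv).abs_le]
  ring

lemma iteratedDeriv_add_two_steinSolution (hh : MemCb (k + 3) h) (x : ℝ) :
    iteratedDeriv (k + 2) (steinSolution h) x
      = x * iteratedDeriv (k + 1) (steinSolution h) x
        + (k + 1) * iteratedDeriv k (steinSolution h) x + iteratedDeriv (k + 1) h x := by
  have hf : MemCb (k + 2) (steinSolution h) := memCb_steinSolution hh
  rw [iteratedDeriv_succ]
  induction k generalizing x with
  | zero =>
    have heq : iteratedDeriv 1 (steinSolution h)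
        = fun x ↦ x * steinSolution h x + (h x - normalMean h) := by
      rw [iteratedDeriv_one]
      exact funext (deriv_steinSolution (hh.mono (by lia)))
    have hf0 : HasDerivAt (steinSolution h) (iteratedDeriv 1 (steinSolution h) x) x := by
      simpa using hf.hasDerivAt (k := 0) two_pos x
    have hh0 : HasDerivAt h (iteratedDeriv 1 h x) x := by
      simpa using hh.hasDerivAt (k := 0) three_pos x
    refine HasDerivAt.deriv ?_
    nth_rw 1 [heq]
    convert! ((hasDerivAt_id' x).mul hf0).add (hh0.sub_const (normalMean h)) using 1
    simp only [zero_add, iteratedDeriv_one, Nat.cast_zero, iteratedDeriv_zero, one_mul]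
    ring
  | succ k ih =>
    have heq : iteratedDeriv (k + 2) (steinSolution h)
        = fun x ↦ x * iteratedDeriv (k + 1) (steinSolution h) x
          + (k + 1) * iteratedDeriv k (steinSolution h) x + iteratedDeriv (k + 1) h x := by
      rw [iteratedDeriv_succ]
      exact funext fun x ↦ ih (hh.mono (by lia)) x (hf.mono (by lia))
    refine HasDerivAt.deriv ?_
    nth_rw 1 [heq]
    convert! (((hasDerivAt_id' x).mul (hf.hasDerivAt (k := k + 1) (by lia) x)).add
      ((hf.hasDerivAt (k := k) (by lia) x).const_mul ((k : ℝ) + 1))).add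
      (hh.hasDerivAt (k := k + 1) (by lia) x) using 1
    push_cast
    ring

lemma abs_normalMean_le (hh : MemCb m h) : |normalMean h| ≤ supNorm h := by
  simpa [normalMean] using norm_integral_le_of_norm_le_const (μ := gaussianReal 0 1) (f := h)
    (ae_of_all _ hh.abs_le)

lemma abs_iteratedDeriv_succ_steinSolution_le (hh : MemCb (k + 2) h) (x : ℝ) :
    |iteratedDeriv (k + 1) (steinSolution h) x| ≤ 2 * supNorm (iteratedDeriv k h) := by
  have hf : MemCb (k + 1) (steinSolution h) := memCb_steinSolution hh
  have hderiv := hf.hasDerivAt k.lt_succ_self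
  have hg := hh.abs_iteratedDeriv_le (k := k) (by lia)
  have hv := hf.abs_iteratedDeriv_le (k := k) (by lia)
  cases k with
  | zero =>
    have hode (x : ℝ) : iteratedDeriv (0 + 1) (steinSolution h) x
        = x * iteratedDeriv 0 (steinSolution h) x + -normalMean h + iteratedDeriv 0 h x := by
      simp only [zero_add, iteratedDeriv_one, iteratedDeriv_zero]
      rw [deriv_steinSolution hh]
      ring
    simp only [hode] at hderiv ⊢
    refine abs_mul_add_add_le (m := 0) (A := fun _ ↦ -normalMean h) le_rfl hderiv (fun y ↦ ?_)
      (fun _ ↦ ?_) hg hv x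
    · simpa using hasDerivAt_const y (-normalMean h)
    · simpa using abs_normalMean_le hh
  | succ k =>
    simp only [iteratedDeriv_add_two_steinSolution hh] at hderiv ⊢
    refine abs_mul_add_add_le (m := k + 1) (by positivity) hderiv
      (fun y ↦ (hf.hasDerivAt (by lia) y).const_mul _) (fun y ↦ ?_) hg hv x
    have := abs_iteratedDeriv_steinSolution_le (hh.mono (m := k + 3) (k := k + 1) (by lia)) y
    rwa [le_div_iff₀' (by positivity), ← abs_of_nonneg (by positivity : (0 : ℝ) ≤ k + 1),
      ← abs_mul] at this

lemma supNorm_steinSolution_le (hh : MemCb 1 h) : supNorm (steinSolution h) ≤ supNorm (deriv h) :=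
  ciSup_le fun x ↦ by simpa using abs_iteratedDeriv_steinSolution_le (k := 0) hh x

lemma supNorm_iteratedDeriv_succ_steinSolution_le (hh : MemCb (k + 2) h) :
    supNorm (iteratedDeriv (k + 1) (steinSolution h)) ≤ steinConst h (k + 1) := by
  have htwo := abs_iteratedDeriv_succ_steinSolution_le hh
  have := supNorm_nonneg (iteratedDeriv k h)
  exact le_min (ciSup_le fun x ↦ (htwo x).trans (by rw [Nat.add_sub_cancel]; gcongr; norm_num))
    (le_min (ciSup_le (abs_iteratedDeriv_steinSolution_le_gamma hh))
      (ciSup_le (abs_iteratedDeriv_steinSolution_le hh)))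

end SteinSolution

section Taylor

variable {m q : ℕ} {f : ℝ → ℝ}

lemma abs_sub_taylor_le (hf : MemCb m f) (w t : ℝ) :
    |f (w + t) - ∑ k ∈ Finset.range m, iteratedDeriv k f w * t ^ k / k !|
      ≤ supNorm (iteratedDeriv m f) * |t| ^ m / m ! := by
  obtain ⟨ξ, hξ⟩ := exists_eq_taylor_add_lagrange hf.differentiable w t
  rw [hξ, add_sub_cancel_left, abs_div, abs_mul, abs_pow, Nat.abs_cast]
  gcongr
  exact hf.abs_iteratedDeriv_le le_rfl ξ

/-- The Taylor polynomial in `s`, of degree `q + 1`, of `s² f'(u + s y) - s y f(u + s y)`. In the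
term `k = 0` the factor `k` cancels the truncated exponent `k - 1`. -/
noncomputable def steinTaylor (f : ℝ → ℝ) (q : ℕ) (s u y : ℝ) : ℝ :=
  ∑ k ∈ Finset.range (q + 1),
    s ^ (k + 1) / k ! * (iteratedDeriv k f u * (k * y ^ (k - 1) - y ^ (k + 1)))

lemma steinTaylor_eq (f : ℝ → ℝ) (q : ℕ) (s u y : ℝ) :
    steinTaylor f q s u y
      = s ^ 2 * (∑ k ∈ Finset.range q, iteratedDeriv k (deriv f) u * (s * y) ^ k / k !)
        - s * y * ∑ k ∈ Finset.range (q + 1), iteratedDeriv k f u * (s * y) ^ k / k ! := by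
  rw [steinTaylor, Finset.sum_range_succ', Finset.sum_range_succ', mul_add, Finset.mul_sum,
    Finset.mul_sum, ← sub_sub, ← Finset.sum_sub_distrib, sub_eq_add_neg]
  congr 1
  · refine Finset.sum_congr rfl fun k _ ↦ ?_
    rw [Nat.add_sub_cancel, ← iteratedDeriv_succ', Nat.factorial_succ]
    push_cast
    field_simp
    ring
  · simp only [iteratedDeriv_zero, pow_zero, Nat.factorial_zero, Nat.cast_zero, Nat.cast_one]
    ring

lemma abs_sub_steinTaylor_le (hf : MemCb (q + 1) f) {s : ℝ} (hs : 0 ≤ s) (u y : ℝ) :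
    |s ^ 2 * deriv f (u + s * y) - s * y * f (u + s * y) - steinTaylor f q s u y|
      ≤ supNorm (iteratedDeriv (q + 1) f) * s ^ (q + 2)
        * (|y| ^ q / q ! + |y| ^ (q + 2) / (q + 1)!) := by
  have htaylor := abs_sub_taylor_le hf u (s * y)
  have htaylor' := abs_sub_taylor_le hf.deriv u (s * y)
  rw [← iteratedDeriv_succ'] at htaylor'
  rw [steinTaylor_eq]
  set r := f (u + s * y) - ∑ k ∈ Finset.range (q + 1), iteratedDeriv k f u * (s * y) ^ k / k !
    with hr
  set r' := deriv f (u + s * y)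
    - ∑ k ∈ Finset.range q, iteratedDeriv k (deriv f) u * (s * y) ^ k / k ! with hr'
  have hsy : |s * y| = s * |y| := by rw [abs_mul, abs_of_nonneg hs]
  calc _ = |s ^ 2 * r' - s * y * r| := by rw [hr, hr']; congr 1; ring
    _ ≤ |s ^ 2 * r'| + |s * y * r| := abs_sub _ _
    _ = s ^ 2 * |r'| + |s * y| * |r| := by rw [abs_mul, abs_mul _ r, abs_of_nonneg (sq_nonneg s)]
    _ ≤ s ^ 2 * (supNorm (iteratedDeriv (q + 1) f) * |s * y| ^ q / q !)
        + |s * y| * (supNorm (iteratedDeriv (q + 1) f) * |s * y| ^ (q + 1) / (q + 1)!) := by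
      gcongr
    _ = _ := by rw [hsy]; ring

end Taylor

section Moments

variable {Ω : Type*} [MeasurableSpace Ω] {μ : Measure Ω} {Y : Ω → ℝ} {k m : ℕ}

lemma integrable_pow_of_le [IsFiniteMeasure μ] (hY : AEStronglyMeasurable Y μ)
    (hmom : Integrable (fun ω ↦ |Y ω| ^ m) μ) (hkm : k ≤ m) :
    Integrable (fun ω ↦ Y ω ^ k) μ := by
  refine (integrable_norm_iff (hY.pow k)).1 ?_
  simpa using integrable_norm_pow_of_le hY hkm hmom

lemma integrable_mul_pow_sub_pow [IsFiniteMeasure μ] (hY : AEStronglyMeasurable Y μ)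
    (hmom : Integrable (fun ω ↦ |Y ω| ^ m) μ) (hkm : k + 1 ≤ m) :
    Integrable (fun ω ↦ k * Y ω ^ (k - 1) - Y ω ^ (k + 1)) μ := by
  have hpred : Integrable (fun ω ↦ k * Y ω ^ (k - 1)) μ :=
    .const_mul (integrable_pow_of_le hY hmom (by lia)) _
  exact hpred.sub (integrable_pow_of_le hY hmom hkm)

lemma integral_mul_pow_sub_pow [IsFiniteMeasure μ] (hY : AEStronglyMeasurable Y μ)
    (hmom : Integrable (fun ω ↦ |Y ω| ^ m) μ) (hkm : k + 1 ≤ m) :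
    ∫ ω, (k * Y ω ^ (k - 1) - Y ω ^ (k + 1)) ∂μ
      = k * momentDiff μ Y (k - 1) - momentDiff μ Y (k + 1) := by
  have hrec : k * ∫ z, z ^ (k - 1) ∂gaussianReal 0 1 = ∫ z, z ^ (k + 1) ∂gaussianReal 0 1 := by
    cases k with
    | zero => simp [integral_id_gaussianReal]
    | succ k => simpa using (integral_sub_pow_add_two_gaussianReal (m := 0) (v := 1) k).symm
  have hpred : Integrable (fun ω ↦ k * Y ω ^ (k - 1)) μ :=
    .const_mul (integrable_pow_of_le hY hmom (by lia)) _
  rw [integral_sub hpred (integrable_pow_of_le hY hmom hkm), integral_const_mul,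
    momentDiff, momentDiff, ← hrec]
  ring

end Moments

section Summand

variable {Ω : Type*} [MeasurableSpace Ω] {μ : Measure Ω} {U V Y : Ω → ℝ} {f : ℝ → ℝ} {q k : ℕ}
  {s : ℝ}

lemma MemCb.measurable_iteratedDeriv (hf : MemCb (q + 1) f) (k : ℕ) :
    Measurable (iteratedDeriv k f) :=
  SteinMoments.measurable_iteratedDeriv hf.continuous.measurable k

lemma integrable_iteratedDeriv_comp_mul (hf : MemCb (q + 1) f) (hk : k ≤ q + 1)
    (hU : Measurable U) (hV : Integrable V μ) :
    Integrable (fun ω ↦ iteratedDeriv k f (U ω) * V ω) μ :=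
  hV.bdd_mul (c := supNorm (iteratedDeriv k f))
    ((hf.measurable_iteratedDeriv k).comp hU).aestronglyMeasurable
    (ae_of_all _ fun _ ↦ hf.abs_iteratedDeriv_le hk _)

lemma integrable_stein_comp [IsFiniteMeasure μ] (hf : MemCb (q + 1) f) (hU : Measurable U)
    (hY : Integrable Y μ) (a b : ℝ) :
    Integrable (fun ω ↦ a * deriv f (U ω) - b * Y ω * f (U ω)) μ := by
  have hderiv := integrable_iteratedDeriv_comp_mul hf (k := 1) (by lia) hU
    (integrable_const (μ := μ) a)
  have hmul := integrable_iteratedDeriv_comp_mul hf (k := 0) (by lia) hU (hY.const_mul b)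
  simp only [iteratedDeriv_one, iteratedDeriv_zero, mul_comm (deriv f _), mul_comm (f _)]
    at hderiv hmul
  exact hderiv.sub hmul

lemma abs_integral_iteratedDeriv_comp_mul_le [IsProbabilityMeasure μ] (hf : MemCb (q + 1) f)
    (hk : k ≤ q + 1) (hU : Measurable U) (hV : AEStronglyMeasurable V μ) (hUV : IndepFun U V μ) :
    |∫ ω, iteratedDeriv k f (U ω) * V ω ∂μ| ≤ supNorm (iteratedDeriv k f) * |∫ ω, V ω ∂μ| := by
  have hmeas := hf.measurable_iteratedDeriv k
  have hmean : |∫ ω, iteratedDeriv k f (U ω) ∂μ| ≤ supNorm (iteratedDeriv k f) := by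
    simpa using norm_integral_le_of_norm_le_const (μ := μ) (f := fun ω ↦ iteratedDeriv k f (U ω))
      (ae_of_all _ fun _ ↦ hf.abs_iteratedDeriv_le hk _)
  have hfactor : ∫ ω, iteratedDeriv k f (U ω) * V ω ∂μ
      = (∫ ω, iteratedDeriv k f (U ω) ∂μ) * ∫ ω, V ω ∂μ :=
    (hUV.comp hmeas measurable_id).integral_fun_mul_eq_mul_integral
      (hmeas.comp hU).aestronglyMeasurable hV
  rw [hfactor, abs_mul]
  gcongr

variable (hf : MemCb (q + 1) f) (hU : Measurable U) (hY : Measurable Y)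
  (hmom : Integrable (fun ω ↦ |Y ω| ^ (q + 2)) μ)

include hf hU hY hmom

lemma integrable_steinTaylor_term [IsFiniteMeasure μ] (hk : k < q + 1) :
    Integrable (fun ω ↦ s ^ (k + 1) / k !
      * (iteratedDeriv k f (U ω) * (k * Y ω ^ (k - 1) - Y ω ^ (k + 1)))) μ :=
  (integrable_iteratedDeriv_comp_mul hf hk.le hU
    (integrable_mul_pow_sub_pow hY.aestronglyMeasurable hmom (by lia))).const_mul _

lemma integrable_steinTaylor [IsFiniteMeasure μ] :
    Integrable (fun ω ↦ steinTaylor f q s (U ω) (Y ω)) μ :=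
  integrable_finsetSum _ fun _ hk ↦
    integrable_steinTaylor_term hf hU hY hmom (Finset.mem_range.1 hk)

lemma abs_integral_steinTaylor_le [IsProbabilityMeasure μ] (hUY : IndepFun U Y μ) (hs : 0 ≤ s) :
    |∫ ω, steinTaylor f q s (U ω) (Y ω) ∂μ|
      ≤ ∑ k ∈ Finset.range (q + 1), s ^ (k + 1) / k ! * (supNorm (iteratedDeriv k f)
        * |k * momentDiff μ Y (k - 1) - momentDiff μ Y (k + 1)|) := by
  simp only [steinTaylor]
  rw [integral_finsetSum _ fun k hk ↦
    integrable_steinTaylor_term hf hU hY hmom (Finset.mem_range.1 hk)]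
  refine (Finset.abs_sum_le_sum_abs _ _).trans (Finset.sum_le_sum fun k hk ↦ ?_)
  have hkq : k < q + 1 := Finset.mem_range.1 hk
  have hcomp : Measurable fun y : ℝ ↦ k * y ^ (k - 1) - y ^ (k + 1) := by fun_prop
  rw [integral_const_mul, abs_mul, abs_of_nonneg (by positivity),
    ← integral_mul_pow_sub_pow hY.aestronglyMeasurable hmom (by lia)]
  gcongr
  exact abs_integral_iteratedDeriv_comp_mul_le hf hkq.le hU
    (hcomp.comp hY).aestronglyMeasurable (hUY.comp measurable_id hcomp)

lemma abs_integral_stein_comp_add_le [IsProbabilityMeasure μ] (hUY : IndepFun U Y μ) (hs : 0 ≤ s) :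
    |∫ ω, (s ^ 2 * deriv f (U ω + s * Y ω) - s * Y ω * f (U ω + s * Y ω)) ∂μ|
      ≤ (∑ k ∈ Finset.range (q + 1), s ^ (k + 1) / k ! * (supNorm (iteratedDeriv k f)
          * |k * momentDiff μ Y (k - 1) - momentDiff μ Y (k + 1)|))
        + supNorm (iteratedDeriv (q + 1) f) * s ^ (q + 2)
          * ((∫ ω, |Y ω| ^ q ∂μ) / q ! + (∫ ω, |Y ω| ^ (q + 2) ∂μ) / (q + 1)!) := by
  have hYint : Integrable Y μ := by
    simpa using integrable_pow_of_le (k := 1) hY.aestronglyMeasurable hmom (by lia)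
  have hY_q : Integrable (fun ω ↦ |Y ω| ^ q) μ := by
    simpa using (integrable_pow_of_le (k := q) hY.aestronglyMeasurable hmom (by lia)).abs
  have hstein := integrable_stein_comp hf (hU.add (hY.const_mul s)) hYint (s ^ 2) s
  have htaylor := integrable_steinTaylor (s := s) hf hU hY hmom
  have hbound : Integrable (fun ω ↦ supNorm (iteratedDeriv (q + 1) f) * s ^ (q + 2)
      * (|Y ω| ^ q / q ! + |Y ω| ^ (q + 2) / (q + 1)!)) μ :=
    ((hY_q.div_const _).add (hmom.div_const _)).const_mul _
  have hremainder := norm_integral_le_of_norm_le (f := fun ω ↦ s ^ 2 * deriv f (U ω + s * Y ω)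
      - s * Y ω * f (U ω + s * Y ω) - steinTaylor f q s (U ω) (Y ω)) hbound
    (ae_of_all μ fun ω ↦ abs_sub_steinTaylor_le hf hs (U ω) (Y ω))
  simp only [Pi.add_apply] at hstein
  rw [integral_const_mul, integral_add (hY_q.div_const _) (hmom.div_const _), integral_div,
    integral_div, integral_sub hstein htaylor, Real.norm_eq_abs] at hremainder
  have hmain := abs_integral_steinTaylor_le hf hU hY hmom hUY hs
  linarith [abs_sub_abs_le_abs_sub
    (∫ ω, (s ^ 2 * deriv f (U ω + s * Y ω) - s * Y ω * f (U ω + s * Y ω)) ∂μ)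
    (∫ ω, steinTaylor f q s (U ω) (Y ω) ∂μ)]

end Summand

lemma rpow_add_one_div_two (n k : ℕ) : (n : ℝ) ^ (((k : ℝ) + 1) / 2) = √n ^ (k + 1) := by
  rw [Real.sqrt_eq_rpow, ← Real.rpow_natCast, ← Real.rpow_mul (by positivity)]
  push_cast
  ring_nf

section Sum

variable {Ω : Type*} {n q : ℕ} {X : Fin n → Ω → ℝ} {f : ℝ → ℝ}

lemma stein_stdSum_eq_sum (hn : n ≠ 0) (f : ℝ → ℝ) (ω : Ω) :
    deriv f (stdSum X ω) - stdSum X ω * f (stdSum X ω)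
      = ∑ i, ((1 / √n) ^ 2 * deriv f (stdSum X ω) - 1 / √n * X i ω * f (stdSum X ω)) := by
  have hnpos : (0 : ℝ) < n := by positivity
  rw [Finset.sum_sub_distrib, ← Finset.sum_mul, ← Finset.sum_mul, ← Finset.mul_sum,
    Finset.sum_const, Finset.card_univ, Fintype.card_fin, nsmul_eq_mul, div_pow,
    Real.sq_sqrt hnpos.le, one_pow, mul_one_div_cancel hnpos.ne', one_mul, stdSum]

variable [MeasurableSpace Ω] {μ : Measure Ω}

lemma measurable_stdSum (hX : ∀ i, Measurable (X i)) : Measurable (stdSum X) :=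
  (Finset.measurable_sum Finset.univ fun i _ ↦ hX i).const_mul _

lemma exists_indepFun_stdSum_eq_add (hX : ∀ i, Measurable (X i))
    (hindep : iIndepFun X μ) (i : Fin n) :
    ∃ U : Ω → ℝ, Measurable U ∧ IndepFun U (X i) μ ∧ ∀ ω, stdSum X ω = U ω + 1 / √n * X i ω := by
  refine ⟨fun ω ↦ 1 / √n * (∑ j ∈ Finset.univ.erase i, X j) ω, ?_, ?_, fun ω ↦ ?_⟩
  · simp only [Finset.sum_apply]
    exact (Finset.measurable_sum _ fun j _ ↦ hX j).const_mul _
  · exact (hindep.indepFun_finsetSum_of_notMem hX (Finset.notMem_erase i _)).comp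
      (measurable_const_mul _) measurable_id
  · rw [stdSum, ← Finset.sum_erase_add _ _ (Finset.mem_univ i), mul_add]
    simp only [Finset.sum_apply]

theorem abs_integral_stein_stdSum_le [IsProbabilityMeasure μ] (hn : n ≠ 0)
    (hX : ∀ i, Measurable (X i)) (hindep : iIndepFun X μ)
    (hmom : ∀ i, Integrable (fun ω ↦ |X i ω| ^ (q + 2)) μ) (hf : MemCb (q + 1) f) :
    |∫ ω, (deriv f (stdSum X ω) - stdSum X ω * f (stdSum X ω)) ∂μ|
      ≤ supNorm f / √n * ∑ i, |momentDiff μ (X i) 1|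
        + ∑ i, ∑ k ∈ Finset.Icc 1 q, supNorm (iteratedDeriv k f)
            / (k ! * (n : ℝ) ^ (((k : ℝ) + 1) / 2))
            * |k * momentDiff μ (X i) (k - 1) - momentDiff μ (X i) (k + 1)|
        + supNorm (iteratedDeriv (q + 1) f) / (n : ℝ) ^ ((((q + 1 : ℕ) : ℝ) + 1) / 2)
          * ∑ i, ((∫ ω, |X i ω| ^ q ∂μ) / q ! + (∫ ω, |X i ω| ^ (q + 2) ∂μ) / (q + 1)!) := by
  have hXint (i : Fin n) : Integrable (X i) μ := by
    simpa using integrable_pow_of_le (k := 1) (hX i).aestronglyMeasurable (hmom i) (by lia)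
  simp only [stein_stdSum_eq_sum hn]
  rw [integral_finsetSum _ fun i _ ↦
    integrable_stein_comp hf (measurable_stdSum hX) (hXint i) _ _, Finset.mul_sum, Finset.mul_sum,
    ← Finset.sum_add_distrib, ← Finset.sum_add_distrib]
  refine (Finset.abs_sum_le_sum_abs _ _).trans (Finset.sum_le_sum fun i _ ↦ ?_)
  obtain ⟨U, hU, hUX, hW⟩ := exists_indepFun_stdSum_eq_add hX hindep i
  simp only [hW]
  refine (abs_integral_stein_comp_add_le hf hU (hX i) (hmom i) hUX (by positivity)).trans_eq ?_
  simp only [rpow_add_one_div_two, one_div_pow]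
  rw [Finset.range_eq_Ico, Finset.sum_eq_sum_Ico_succ_bot q.succ_pos, Nat.succ_eq_add_one, zero_add,
    Finset.Ico_add_one_right_eq_Icc, mul_one_div]
  congr 2
  · simp only [pow_one, Nat.factorial_zero, Nat.cast_one, Nat.cast_zero, iteratedDeriv_zero,
      zero_mul, zero_sub, abs_neg]
    ring
  · refine Finset.sum_congr rfl fun k _ ↦ ?_
    field_simp

end Sum

end SteinMoments

open SteinMoments in
theorem mainTheorem3 {Ω : Type*} [MeasurableSpace Ω] (μ : Measure Ω) [IsProbabilityMeasure μ]
    (n p : ℕ) (hn : 1 ≤ n) (hp : 1 ≤ p) (X : Fin n → Ω → ℝ)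
    (hX : ∀ i, Measurable (X i)) (hindep : iIndepFun X μ)
    (hmom : ∀ i, Integrable (fun ω => |X i ω| ^ (p + 1)) μ)
    (h : ℝ → ℝ) (hh : SteinMoments.MemCb (p + 1) h) :
    |(∫ ω, h (SteinMoments.stdSum X ω) ∂μ) - SteinMoments.normalMean h| ≤
      SteinMoments.supNorm (deriv h) / Real.sqrt (n : ℝ)
          * ∑ i, |SteinMoments.momentDiff μ (X i) 1|
        + ∑ i, ∑ k ∈ Finset.Icc 1 (p - 1),
            SteinMoments.steinConst h k / ((k.factorial : ℝ) * (n : ℝ) ^ (((k : ℝ) + 1) / 2))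
              * |(k : ℝ) * SteinMoments.momentDiff μ (X i) (k - 1)
                  - SteinMoments.momentDiff μ (X i) (k + 1)|
        + SteinMoments.steinConst h p / (n : ℝ) ^ (((p : ℝ) + 1) / 2)
            * ∑ i, ((∫ ω, |X i ω| ^ (p - 1) ∂μ) / ((p - 1).factorial : ℝ)
                + (∫ ω, |X i ω| ^ (p + 1) ∂μ) / (p.factorial : ℝ)) := by
  obtain ⟨q, rfl⟩ := Nat.exists_eq_add_of_le' hp
  rw [Nat.add_sub_cancel]
  have hf : MemCb (q + 1) (steinSolution h) := memCb_steinSolution hh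
  have hhint : Integrable (fun ω ↦ h (stdSum X ω)) μ :=
    .of_bound (hh.continuous.measurable.comp (measurable_stdSum hX)).aestronglyMeasurable
      (supNorm h) (ae_of_all _ fun _ ↦ hh.abs_le _)
  have hstein : (∫ ω, h (stdSum X ω) ∂μ) - normalMean h = ∫ ω, (deriv (steinSolution h)
      (stdSum X ω) - stdSum X ω * steinSolution h (stdSum X ω)) ∂μ := by
    simp [deriv_steinSolution (hh.mono (by lia)), integral_sub hhint (integrable_const _)]
  have hnorm (k : ℕ) (hk : k ∈ Finset.Icc 1 (q + 1)) :
      supNorm (iteratedDeriv k (steinSolution h)) ≤ steinConst h k := by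
    obtain ⟨j, rfl⟩ := Nat.exists_eq_add_of_le' (Finset.mem_Icc.1 hk).1
    exact supNorm_iteratedDeriv_succ_steinSolution_le (hh.mono (by grind))
  rw [hstein]
  refine (abs_integral_stein_stdSum_le (by lia) hX hindep hmom hf).trans ?_
  gcongr with i _ k hk
  · exact supNorm_steinSolution_le (hh.mono (by lia))
  · exact hnorm k (by grind)
  · exact hnorm (q + 1) (by grind)
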